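/- **Hilbert's Theorem 33, first part.** For a commutative ring $A$ and a commutative $A$-algebra $C$ that is finite and free as an $A$-module, put $C^\vee=\mathrm{Hom}_A(C,A)$. The *generic element* $\xi_C\in \mathrm{Sym}_A(C^\vee)\otimes_A C$ is the image of the element of $C^\vee\otimes_A C$ corresponding to $\mathrm{id}_C$ under $C^\vee\otimes_A C\simeq \mathrm{End}_A(C)$ (if $(c_i)$ is a basis of $C$ with dual basis $(T_i)$, then $\mathrm{Sym}_A(C^\vee)=A[T_1,\dots,T_n]$ and $\xi_C=\sum_i T_i c_i$). The *generic characteristic polynomial* $F_{C/A}\in \mathrm{Sym}_A(C^\vee)[X]$ is the characteristic polynomial of multiplication by $\xi_C$ on the free $\mathrm{Sym}_A(C^\vee)$-module $\mathrm{Sym}_A(C^\vee)\otimes_A C$. Let $K$ be a number field, $B$ its ring of integers, $S=\mathrm{Sym}_{\mathbb Z}(B^\vee)$, and $F=F_{B/\mathbb Z}\in S[X]$. Let $p$ be a prime number and let $pB=\prod_{i\in I}\mathfrak p_i^{e_i}$ with $I$ finite, the $\mathfrak p_i$ pairwise distinct prime ideals of $B$, and all $e_i\ge 1$. For each $i$ let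 $G_i\in \mathrm{Sym}_{\mathbb F_p}((B/\mathfrak p_i)^\vee)[X]$ be the generic characteristic polynomial of the $\mathbb F_p$-algebra $B/\mathfrak p_i$, and let $$v_i:\mathrm{Sym}_{\mathbb F_p}((B/\mathfrak p_i)^\vee)\to \mathrm{Sym}_{\mathbb F_p}((B/pB)^\vee)$$ be the morphism induced by the transpose of the projection $B/pB\to B/\mathfrak p_i$. Let $\mathrm{red}: S\to \mathrm{Sym}_{\mathbb F_p}((B/pB)^\vee)$ be reduction modulo $p$, i.e. the ring morphism sending each linear form $\beta\in B^\vee$ to the form $B/pB\to\mathbb F_p$ it induces. (Morphisms of coefficient rings are applied to polynomials coefficientwise.) Then there are polynomials $\Pi_i\in S[X]$ $(i\in I)$ such that 1. $\mathrm{red}(\Pi_i)=v_i(G_i)$ for every $i$; 2. $F\equiv\prod_{i\in I}\Pi_i^{e_i}\pmod p$, i.e. both sides have the same image in $(S/pS)[X]$; 3. the images of the $\Pi_i$ in $(S/pS)[X]$ are irreducible and pairwise distinct. -/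

import Mathlib

open scoped TensorProduct

noncomputable section

namespace GenericElement

section General

variable (A B : Type*) [CommRing A] [CommRing B] [Algebra A B]

/-- The ring of parameters of an `A`-algebra `B`: the symmetric algebra over `A` of the dual
`A`-module `Hom_A(B, A)`. For a basis of `B` it is the polynomial ring `A[T₁, …, Tₙ]` in the
coordinate forms. -/
abbrev ParameterRing : Type _ := SymmetricAlgebra A (Module.Dual A B)

/-- The generic element of `B`: the element of `Sym_A(B^∨) ⊗ B` given by the element of `B^∨ ⊗ B`
that corresponds to `id_B` under the isomorphism `B^∨ ⊗ B ≃ End_A(B)`, `β ⊗ x ↦ (b ↦ β(b) x)`. -/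
def genericElement [Module.Free A B] [Module.Finite A B] : ParameterRing A B ⊗[A] B :=
  LinearMap.rTensor B (SymmetricAlgebra.ι A (Module.Dual A B))
    ((dualTensorHomEquiv A B B).symm LinearMap.id)

/-- The generic characteristic polynomial `F_{B/A}`: the characteristic polynomial of
multiplication by the generic element on the finite free `Sym_A(B^∨)`-module `Sym_A(B^∨) ⊗ B`. -/
def genericCharpoly [Module.Free A B] [Module.Finite A B] : Polynomial (ParameterRing A B) :=
  (LinearMap.mulLeft (ParameterRing A B) (genericElement A B)).charpoly

variable {A B}

/-- The contravariant functoriality of the ring of parameters: the morphism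
`Sym_A(C^∨) → Sym_A(B^∨)` induced by the transpose of `u : B → C`. -/
def parameterMap {C : Type*} [CommRing C] [Algebra A C] (u : B →ₐ[A] C) :
    ParameterRing A C →ₐ[A] ParameterRing A B :=
  SymmetricAlgebra.lift
    (SymmetricAlgebra.ι A (Module.Dual A B) ∘ₗ u.toLinearMap.dualMap)

/-- With a basis `b`, the generic element is `∑ Tᵢ ⊗ bᵢ`, where `Tᵢ` is the `i`-th coordinate. -/
theorem genericElement_eq_sum [Module.Free A B] [Module.Finite A B] {κ : Type*} [Fintype κ]
    [DecidableEq κ] (b : Module.Basis κ A B) :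
    genericElement A B = ∑ i, SymmetricAlgebra.ι A (Module.Dual A B) (b.coord i) ⊗ₜ[A] b i := by
  have h : (dualTensorHomEquiv A B B).symm LinearMap.id = ∑ i, b.coord i ⊗ₜ[A] b i := by
    rw [LinearEquiv.symm_apply_eq]
    refine b.ext fun j => ?_
    simp [dualTensorHomEquiv, Finsupp.single_apply]
  rw [genericElement, h, map_sum]
  simp

end General

section ModP

variable {B : Type*} [CommRing B] (p : ℕ)

/-- The `𝔽_p`-algebra structure of `B / I` for an ideal `I` that contains `p`. -/
abbrev zmodAlgebraQuotient (I : Ideal B) (h : Ideal.span {(p : B)} ≤ I) :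
    Algebra (ZMod p) (B ⧸ I) :=
  ZMod.algebra' (B ⧸ I) (ringChar (B ⧸ I)) <| (ringChar.spec (B ⧸ I) p).mp <| by
    rw [← map_natCast (Ideal.Quotient.mk I)]
    exact Ideal.Quotient.eq_zero_iff_mem.mpr (h (Ideal.mem_span_singleton_self _))

instance instAlgebraZModQuotientSpan : Algebra (ZMod p) (B ⧸ Ideal.span {(p : B)}) :=
  zmodAlgebraQuotient p _ le_rfl

theorem finite_zmod_quotient [Module.Finite ℤ B] (I : Ideal B) [Algebra (ZMod p) (B ⧸ I)] :
    Module.Finite (ZMod p) (B ⧸ I) := by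
  have : Module.Finite ℤ (B ⧸ I) :=
    Module.Finite.of_surjective (Ideal.Quotient.mk I).toAddMonoidHom.toIntLinearMap
      Ideal.Quotient.mk_surjective
  exact Module.Finite.of_restrictScalars_finite ℤ (ZMod p) (B ⧸ I)

/-- Reduction modulo `p` of linear forms: `β : B → ℤ` induces `B / pB → 𝔽_p`. -/
def reduceDual :
    Module.Dual ℤ B →+ Module.Dual (ZMod p) (B ⧸ Ideal.span {(p : B)}) :=
  AddMonoidHom.mk' (fun β => AddMonoidHom.toZModLinearMap p <|
    QuotientAddGroup.lift (Ideal.span {(p : B)}).toAddSubgroup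
      ((Int.castAddHom (ZMod p)).comp β.toAddMonoidHom) <| by
        intro x hx
        obtain ⟨y, rfl⟩ := Ideal.mem_span_singleton'.mp hx
        have : y * (p : B) = (p : ℤ) • y := by
          rw [zsmul_eq_mul, mul_comm, Int.cast_natCast]
        rw [this]
        change ((β ((p : ℤ) • y) : ℤ) : ZMod p) = 0
        rw [map_zsmul, smul_eq_mul, Int.cast_mul, Int.cast_natCast, CharP.cast_eq_zero, zero_mul])
    fun β γ => by
      refine LinearMap.ext fun x => ?_
      obtain ⟨x, rfl⟩ := Ideal.Quotient.mk_surjective x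
      exact Int.cast_add (β x) (γ x)

theorem reduceDual_mk (β : Module.Dual ℤ B) (x : B) :
    reduceDual p β (Ideal.Quotient.mk _ x) = (β x : ZMod p) := rfl

/-- Reduction modulo `p` of the ring of parameters of `B`, with values in the ring of parameters
of the `𝔽_p`-algebra `B / pB`; it sends each linear form to its reduction. With a basis of `B`
over `ℤ` this is `ℤ[T₁, …, Tₙ] → 𝔽_p[T₁, …, Tₙ]`. -/
def reduceParameters :
    ParameterRing ℤ B →+* ParameterRing (ZMod p) (B ⧸ Ideal.span {(p : B)}) :=
  (SymmetricAlgebra.lift ((SymmetricAlgebra.ι (ZMod p)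
    (Module.Dual (ZMod p) (B ⧸ Ideal.span {(p : B)}))).toAddMonoidHom.comp
      (reduceDual p)).toIntLinearMap).toRingHom

theorem reduceParameters_ι (β : Module.Dual ℤ B) :
    reduceParameters p (SymmetricAlgebra.ι ℤ (Module.Dual ℤ B) β) =
      SymmetricAlgebra.ι (ZMod p) _ (reduceDual p β) :=
  SymmetricAlgebra.lift_ι_apply _ β

/-- Reduction modulo `p` of polynomials over a ring `S`: the map `S[X] → (S / pS)[X]`. Two
polynomials are congruent modulo `p` when they have the same image. -/
def polyModP {S : Type*} [CommRing S] :
    Polynomial S →+* Polynomial (S ⧸ Ideal.span {(p : S)}) :=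
  Polynomial.mapRingHom (Ideal.Quotient.mk (Ideal.span {(p : S)}))

/-- For an ideal `P ⊇ pB`, the image in `Sym((B / pB)^∨)[X]` of the generic characteristic
polynomial of the `𝔽_p`-algebra `B / P`, under the morphism of rings of parameters
`Sym((B / P)^∨) → Sym((B / pB)^∨)` associated with the projection `B / pB → B / P`. -/
def residueCharpoly [Fact p.Prime] [Module.Finite ℤ B] (P : Ideal B)
    (h : Ideal.span {(p : B)} ≤ P) :
    Polynomial (ParameterRing (ZMod p) (B ⧸ Ideal.span {(p : B)})) :=
  letI : Algebra (ZMod p) (B ⧸ P) := zmodAlgebraQuotient p P h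
  haveI : Module.Finite (ZMod p) (B ⧸ P) := finite_zmod_quotient p P
  let π : (B ⧸ Ideal.span {(p : B)}) →ₐ[ZMod p] B ⧸ P :=
    { Ideal.Quotient.factor h with
      commutes' := fun r => congrArg (fun f : ZMod p →+* B ⧸ P => f r) (Subsingleton.elim
        ((Ideal.Quotient.factor h).comp (algebraMap (ZMod p) _)) (algebraMap (ZMod p) _)) }
  (genericCharpoly (ZMod p) (B ⧸ P)).map (parameterMap π).toRingHom

end ModP

end GenericElement

end

open GenericElement

/-! Reduction of coefficients identifies `S / pS` with `Sym((B / pB)^∨)`, so everything can be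
checked there. For an ideal `I ⊇ pB`, `residueCharpoly p I` is the characteristic polynomial of the
generic element of `B / pB` acting on `B / I`: the parameters stay fixed and only the module varies.
It is therefore multiplicative in exact sequences. Filtering `B / pB` by products of the `P i`, with
each graded piece `J / JP ≃ B / P`, gives the factorization (`residueCharpoly_mul`,
`residueCharpoly_prod`). The other two claims follow by specializing the parameters at a well-chosen
element: a primitive element of `B / P` turns the factor into an irreducible minimal polynomial
(`residueCharpoly_irreducible`), and an element that is `0` modulo `P` and `1` modulo `Q` separates
`P` from `Q` (`residueCharpoly_injective`). -/

noncomputable section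

namespace GenericElement

open Polynomial LinearMap

/-! ### Characteristic polynomials of linear combinations of endomorphisms -/

section Pencil

variable {k R κ : Type*} [CommRing k] [CommRing R] [Algebra k R] [Fintype κ]

/-- The characteristic polynomial of the combination `∑ tⱼ fⱼ` of endomorphisms `fⱼ` of a
finite free `k`-module, with coefficients `tⱼ` in a `k`-algebra `R`. -/
def pencilCharpoly {M : Type*} [AddCommGroup M] [Module k M] [Module.Free k M] [Module.Finite k M]
    (t : κ → R) (f : κ → Module.End k M) : R[X] :=
  (∑ j, t j • (f j).baseChange R).charpoly

theorem pencilCharpoly_eq_matrix {M : Type*} [AddCommGroup M] [Module k M] [Module.Free k M]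
    [Module.Finite k M] {n : Type*} [Fintype n] [DecidableEq n] (c : Module.Basis n k M)
    (t : κ → R) (f : κ → Module.End k M) :
    pencilCharpoly t f = (∑ j, t j • (toMatrix c c (f j)).map (algebraMap k R)).charpoly := by
  rw [pencilCharpoly, ← LinearMap.charpoly_toMatrix _ (Algebra.TensorProduct.basis R c)]
  congr 1
  rw [map_sum]
  refine Finset.sum_congr rfl fun j _ => ?_
  rw [map_smul]
  congr 1
  exact LinearMap.toMatrix_baseChange (A := R) (f j) c c

theorem pencilCharpoly_map {M : Type*} [AddCommGroup M] [Module k M] [Module.Free k M]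
    [Module.Finite k M] {S : Type*} [CommRing S] [Algebra k S] (φ : R →ₐ[k] S)
    (t : κ → R) (f : κ → Module.End k M) :
    (pencilCharpoly t f).map φ.toRingHom = pencilCharpoly (fun j => φ (t j)) f := by
  let c := Module.Free.chooseBasis k M
  rw [pencilCharpoly_eq_matrix c, pencilCharpoly_eq_matrix c, ← Matrix.charpoly_map]
  congr 1
  ext x y
  simp [Matrix.sum_apply]

theorem pencilCharpoly_self {M : Type*} [AddCommGroup M] [Module k M] [Module.Free k M]
    [Module.Finite k M] (t : κ → k) (f : κ → Module.End k M) :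
    pencilCharpoly t f = (∑ j, t j • f j).charpoly := by
  let c := Module.Free.chooseBasis k M
  rw [pencilCharpoly_eq_matrix c, ← LinearMap.charpoly_toMatrix _ c]
  congr 1
  ext x y
  simp [Matrix.sum_apply]

theorem pencilCharpoly_monic {M : Type*} [AddCommGroup M] [Module k M] [Module.Free k M]
    [Module.Finite k M] (t : κ → R) (f : κ → Module.End k M) : (pencilCharpoly t f).Monic :=
  LinearMap.charpoly_monic _

/-- A change of parameters: `∑ₗ (∑ⱼ aₗⱼ tⱼ) fₗ = ∑ⱼ tⱼ (∑ₗ aₗⱼ fₗ)`. -/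
theorem pencilCharpoly_change {M : Type*} [AddCommGroup M] [Module k M] [Module.Free k M]
    [Module.Finite k M] {κ' : Type*} [Fintype κ'] (a : κ' → κ → k) (t : κ → R)
    (f : κ' → Module.End k M) :
    pencilCharpoly (fun l => ∑ j, a l j • t j) f = pencilCharpoly t (fun j => ∑ l, a l j • f l) := by
  let c := Module.Free.chooseBasis k M
  rw [pencilCharpoly_eq_matrix c, pencilCharpoly_eq_matrix c]
  congr 1
  ext x y
  simp only [map_sum, map_smul, Matrix.sum_apply, Matrix.smul_apply, Matrix.map_apply, smul_eq_mul,
    Finset.sum_mul, Finset.mul_sum, map_mul]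
  rw [Finset.sum_comm]
  refine Finset.sum_congr rfl fun j _ => Finset.sum_congr rfl fun l _ => ?_
  rw [Algebra.smul_def]
  ring

/-- The characteristic polynomial of a combination of endomorphisms is multiplicative in short
exact sequences. -/
theorem pencilCharpoly_of_exact {N M Q : Type*} [AddCommGroup N] [Module k N] [Module.Free k N]
    [Module.Finite k N] [AddCommGroup M] [Module k M] [Module.Free k M] [Module.Finite k M]
    [AddCommGroup Q] [Module k Q] [Module.Free k Q] [Module.Finite k Q]
    {g : N →ₗ[k] M} {h : M →ₗ[k] Q} (hg : Function.Injective g) (hh : Function.Surjective h)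
    (hgh : Function.Exact g h) (t : κ → R) {fN : κ → Module.End k N} {fM : κ → Module.End k M}
    {fQ : κ → Module.End k Q} (hfg : ∀ j x, fM j (g x) = g (fN j x))
    (hfh : ∀ j x, h (fM j x) = fQ j (h x)) :
    pencilCharpoly t fM = pencilCharpoly t fN * pencilCharpoly t fQ := by
  classical
  -- `Q` is free, so the sequence splits; in a basis adapted to the splitting every `fM j` is block
  -- upper triangular.
  obtain ⟨l, hl⟩ := Module.projective_lifting_property h LinearMap.id hh
  obtain ⟨e, he₁, he₂⟩ := hgh.splitSurjectiveEquiv hg ⟨l, hl⟩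
  let cN := Module.Free.chooseBasis k N
  let cQ := Module.Free.chooseBasis k Q
  let c := (cN.prod cQ).map e.symm
  have heg : ∀ x, e (g x) = (x, 0) := fun x => by rw [he₁]; simp
  have heh : ∀ x, (e x).2 = h x := fun x => by rw [he₂]; simp
  have hcl : ∀ i, c (Sum.inl i) = g (cN i) := fun i => by simp [c, he₁]
  have hcr : ∀ i, h (c (Sum.inr i)) = cQ i := fun i => by simp [c, ← heh]
  -- The upper right block does not affect the characteristic polynomial; it is named only so that
  -- the two matrices agree.
  rw [pencilCharpoly_eq_matrix c, pencilCharpoly_eq_matrix cN, pencilCharpoly_eq_matrix cQ,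
    ← Matrix.charpoly_fromBlocks_zero₂₁ (M₁₂ := Matrix.of fun x y =>
      ∑ j, t j * algebraMap k R (toMatrix c c (fM j) (Sum.inl x) (Sum.inr y)))]
  congr 1
  ext x y
  rcases x with x | x <;> rcases y with y | y
  · simp only [Matrix.sum_apply, Matrix.smul_apply, Matrix.map_apply, Matrix.fromBlocks_apply₁₁,
      LinearMap.toMatrix_apply, hcl, hfg]
    simp [c, heg]
  · simp [Matrix.sum_apply]
  · simp only [Matrix.sum_apply, Matrix.smul_apply, Matrix.map_apply, Matrix.fromBlocks_apply₂₁,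
      LinearMap.toMatrix_apply, hcl, hfg]
    simp [c, heg]
  · simp only [Matrix.sum_apply, Matrix.smul_apply, Matrix.map_apply, Matrix.fromBlocks_apply₂₂,
      LinearMap.toMatrix_apply, ← hcr, ← hfh]
    simp [c, heh]

end Pencil

/-! ### Generic characteristic polynomials: change of algebra and specialization -/

section Generic

variable {k A C : Type*} [CommRing k] [CommRing A] [CommRing C] [Algebra k A] [Algebra k C]
  [Module.Free k C] [Module.Finite k C]

theorem genericCharpoly_eq_pencilCharpoly {κ : Type*} [Fintype κ] (c : Module.Basis κ k C) :
    genericCharpoly k C =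
      pencilCharpoly (fun l => SymmetricAlgebra.ι k (Module.Dual k C) (c.coord l))
        (fun l => mulLeft k (c l)) := by
  classical
  rw [genericCharpoly, pencilCharpoly, genericElement_eq_sum c]
  congr 1
  refine TensorProduct.AlgebraTensorModule.ext fun r x => ?_
  simp [Finset.mul_sum, LinearMap.sum_apply, TensorProduct.smul_tmul', mul_comm]

/-- The image of the generic characteristic polynomial of `C` in the ring of parameters of `A`,
in terms of a basis of `A`. -/
theorem genericCharpoly_map_parameterMap {κ : Type*} [Fintype κ] (a : Module.Basis κ k A)
    (u : A →ₐ[k] C) :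
    (genericCharpoly k C).map (parameterMap u).toRingHom =
      pencilCharpoly (fun j => SymmetricAlgebra.ι k (Module.Dual k A) (a.coord j))
        (fun j => mulLeft k (u (a j))) := by
  classical
  let c := Module.Free.chooseBasis k C
  rw [genericCharpoly_eq_pencilCharpoly c, pencilCharpoly_map]
  have h₁ : ∀ l, parameterMap u (SymmetricAlgebra.ι k (Module.Dual k C) (c.coord l)) =
      ∑ j, c.coord l (u (a j)) • SymmetricAlgebra.ι k (Module.Dual k A) (a.coord j) := fun l => by
    rw [parameterMap, SymmetricAlgebra.lift_ι_apply, LinearMap.comp_apply]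
    simp_rw [← map_smul, ← map_sum]
    congr 1
    refine a.ext fun j => ?_
    simp [Finsupp.single_apply]
  simp_rw [h₁]
  rw [pencilCharpoly_change]
  congr 1
  funext j
  ext x
  simp only [LinearMap.sum_apply, LinearMap.smul_apply, mulLeft_apply, ← smul_mul_assoc,
    ← Finset.sum_mul]
  exact congrArg (· * x) (c.sum_repr (u (a j)))

/-- The specialization of parameters at an element `x` of `A`. -/
def evalParameters (x : A) : ParameterRing k A →ₐ[k] k :=
  SymmetricAlgebra.lift (Module.Dual.eval k A x)

/-- Evaluating the coordinate forms at `x` recombines the basis into `x` itself, so the generic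
element becomes `u x`. -/
theorem genericCharpoly_map_eval [Module.Free k A] [Module.Finite k A] (u : A →ₐ[k] C) (x : A) :
    ((genericCharpoly k C).map (parameterMap u).toRingHom).map
      (evalParameters (k := k) x).toRingHom = (mulLeft k (u x)).charpoly := by
  let a := Module.Free.chooseBasis k A
  rw [genericCharpoly_map_parameterMap a, pencilCharpoly_map, pencilCharpoly_self]
  congr 1
  ext y
  simp only [evalParameters, SymmetricAlgebra.lift_ι_apply, LinearMap.sum_apply,
    LinearMap.smul_apply, mulLeft_apply, ← smul_mul_assoc, ← Finset.sum_mul, ← map_smul, ← map_sum]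
  exact congrArg (fun z => u z * y) (a.sum_repr x)

end Generic

end GenericElement

end

noncomputable section

namespace GenericElement

open Polynomial LinearMap

/-- The multiset contains each `i` with multiplicity `e i`; this allows induction on one prime
factor at a time. -/
theorem prod_map_sum_nsmul_singleton {ι N : Type*} [Fintype ι] [CommMonoid N] (e : ι → ℕ)
    (f : ι → N) : ((∑ i, e i • ({i} : Multiset ι)).map f).prod = ∏ i, f i ^ e i := by
  rw [← Multiset.coe_mapAddMonoidHom, map_sum, Multiset.prod_sum]
  simp [Multiset.map_nsmul, Multiset.prod_nsmul]

/-! ### Reduction modulo `p` -/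

section Reduction

variable {B : Type*} [CommRing B] (p : ℕ)

theorem intCast_smul_mk (n : ℤ) (x : B) :
    (n : ZMod p) • Ideal.Quotient.mk (Ideal.span {(p : B)}) x =
      Ideal.Quotient.mk (Ideal.span {(p : B)}) (n • x) := by
  rw [Int.cast_smul_eq_zsmul, map_zsmul]

/-- The reduction modulo `p` of a `ℤ`-basis. -/
def reduceBasis {κ : Type*} [Fintype κ] (b : Module.Basis κ ℤ B) :
    Module.Basis κ (ZMod p) (B ⧸ Ideal.span {(p : B)}) :=
  Module.Basis.ofEquivFun <| LinearEquiv.ofLinearMap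
    (LinearMap.pi fun i => reduceDual p (b.coord i))
    (Fintype.linearCombination (ZMod p) fun i => Ideal.Quotient.mk _ (b i))
    (by
      classical
      refine LinearMap.pi_ext' fun j => LinearMap.ext_ring <| funext fun i => ?_
      simp [reduceDual_mk, Finsupp.single_apply, Pi.single_apply, eq_comm])
    (by
      refine LinearMap.ext fun x => ?_
      obtain ⟨x, rfl⟩ := Ideal.Quotient.mk_surjective x
      simp only [LinearMap.comp_apply, Fintype.linearCombination_apply, LinearMap.pi_apply,
        reduceDual_mk, intCast_smul_mk, ← map_sum, Module.Basis.coord_apply, b.sum_repr,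
        LinearMap.id_apply])

theorem reduceBasis_apply {κ : Type*} [Fintype κ] (b : Module.Basis κ ℤ B) (i : κ) :
    reduceBasis p b i = Ideal.Quotient.mk _ (b i) := by
  classical
  simp [reduceBasis]

theorem reduceBasis_coord {κ : Type*} [Fintype κ] (b : Module.Basis κ ℤ B) (i : κ) :
    (reduceBasis p b).coord i = reduceDual p (b.coord i) :=
  LinearMap.ext fun _ => rfl

theorem reduceBasis_dualBasis {κ : Type*} [Fintype κ] [DecidableEq κ] (b : Module.Basis κ ℤ B)
    (i : κ) : (reduceBasis p b).dualBasis i = reduceDual p (b.dualBasis i) := by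
  rw [Module.Basis.coe_dualBasis, Module.Basis.coe_dualBasis, reduceBasis_coord]

/-- In the coordinates given by a basis, `reduceParameters` is reduction of the coefficients. -/
theorem equivMvPolynomial_reduceParameters {κ : Type*} [Fintype κ] [DecidableEq κ]
    (b : Module.Basis κ ℤ B) (s : ParameterRing ℤ B) :
    SymmetricAlgebra.equivMvPolynomial (reduceBasis p b).dualBasis (reduceParameters p s) =
      MvPolynomial.map (Int.castRingHom (ZMod p))
        (SymmetricAlgebra.equivMvPolynomial b.dualBasis s) := by
  obtain ⟨s, rfl⟩ := (SymmetricAlgebra.equivMvPolynomial b.dualBasis).symm.surjective s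
  rw [AlgEquiv.apply_symm_apply]
  induction s using MvPolynomial.induction_on with
  | C n => simp
  | add f g hf hg => simp only [map_add, hf, hg]
  | mul_X f i hf =>
    rw [map_mul, map_mul, map_mul, map_mul, hf, SymmetricAlgebra.equivMvPolynomial_symm_X,
      reduceParameters_ι, ← reduceBasis_dualBasis, SymmetricAlgebra.equivMvPolynomial_ι_apply,
      MvPolynomial.map_X]

theorem residueCharpoly_eq_pencilCharpoly [Module.Finite ℤ B] [Fact p.Prime] {κ : Type*} [Fintype κ]
    (b : Module.Basis κ ℤ B) (I : Ideal B) (h : Ideal.span {(p : B)} ≤ I) :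
    letI : Algebra (ZMod p) (B ⧸ I) := zmodAlgebraQuotient p I h
    haveI : Module.Finite (ZMod p) (B ⧸ I) := finite_zmod_quotient p I
    residueCharpoly p I h =
      pencilCharpoly (fun j => SymmetricAlgebra.ι (ZMod p) _ (reduceDual p (b.coord j)))
        (fun j => mulLeft (ZMod p) (Ideal.Quotient.mk I (b j))) := by
  let : Algebra (ZMod p) (B ⧸ I) := zmodAlgebraQuotient p I h
  have : Module.Finite (ZMod p) (B ⧸ I) := finite_zmod_quotient p I
  rw [residueCharpoly, genericCharpoly_map_parameterMap (reduceBasis p b)]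
  simp_rw [reduceBasis_coord, reduceBasis_apply]
  rfl

/-- The specialization of `residueCharpoly` at the class of `x`. -/
theorem residueCharpoly_map_eval [Module.Finite ℤ B] [Fact p.Prime] (I : Ideal B)
    (h : Ideal.span {(p : B)} ≤ I) (x : B) :
    letI : Algebra (ZMod p) (B ⧸ I) := zmodAlgebraQuotient p I h
    haveI : Module.Finite (ZMod p) (B ⧸ I) := finite_zmod_quotient p I
    (residueCharpoly p I h).map (evalParameters (k := ZMod p)
      (Ideal.Quotient.mk (Ideal.span {(p : B)}) x)).toRingHom =
        (mulLeft (ZMod p) (Ideal.Quotient.mk I x)).charpoly := by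
  let : Algebra (ZMod p) (B ⧸ I) := zmodAlgebraQuotient p I h
  have : Module.Finite (ZMod p) (B ⧸ I) := finite_zmod_quotient p I
  have : Module.Finite (ZMod p) (B ⧸ Ideal.span {(p : B)}) := finite_zmod_quotient p _
  exact genericCharpoly_map_eval _ _

/-- If `P ≠ Q`, they are comaximal, and some `x` lies in `P` with `x ≡ 1` modulo `Q`. Specializing
at `x` gives a positive power of `X` on one side and a power of `X - 1` on the other; their constant
terms differ. -/
theorem residueCharpoly_injective [Module.Finite ℤ B] [Fact p.Prime] {P Q : Ideal B}
    (hP : P.IsMaximal) (hQ : Q.IsMaximal)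
    {hp : Ideal.span {(p : B)} ≤ P} {hq : Ideal.span {(p : B)} ≤ Q}
    (h : residueCharpoly p P hp = residueCharpoly p Q hq) : P = Q := by
  by_contra hne
  obtain ⟨x, hx, y, hy, hxy⟩ := Submodule.mem_sup.mp
    ((Ideal.eq_top_iff_one _).mp (hP.coprime_of_ne hQ hne))
  let : Algebra (ZMod p) (B ⧸ P) := zmodAlgebraQuotient p P hp
  have : Module.Finite (ZMod p) (B ⧸ P) := finite_zmod_quotient p P
  let : Algebra (ZMod p) (B ⧸ Q) := zmodAlgebraQuotient p Q hq
  have : Module.Finite (ZMod p) (B ⧸ Q) := finite_zmod_quotient p Q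
  have : Nontrivial (B ⧸ P) := Ideal.Quotient.nontrivial_iff.mpr hP.ne_top
  have h₁ := congrArg (fun f => (f.map (evalParameters (k := ZMod p)
    (Ideal.Quotient.mk (Ideal.span {(p : B)}) x)).toRingHom).eval 0) h
  have hx0 : Ideal.Quotient.mk P x = 0 := Ideal.Quotient.eq_zero_iff_mem.mpr hx
  have hx1 : Ideal.Quotient.mk Q x = 1 := by
    rw [← map_one (Ideal.Quotient.mk Q), ← hxy, map_add, Ideal.Quotient.eq_zero_iff_mem.mpr hy,
      add_zero]
  simp only [residueCharpoly_map_eval, hx0, hx1] at h₁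
  rw [mulLeft_zero_eq_zero, mulLeft_one, ← Module.End.one_eq_id, LinearMap.charpoly_zero,
    LinearMap.charpoly_one] at h₁
  simp only [eval_pow, eval_sub, eval_X, eval_one] at h₁
  rw [zero_pow Module.finrank_pos.ne'] at h₁
  exact pow_ne_zero _ (by simp) h₁.symm

variable [Module.Free ℤ B] [Module.Finite ℤ B]

theorem reduceParameters_surjective :
    Function.Surjective (reduceParameters p : ParameterRing ℤ B →+* _) := by
  classical
  let b := Module.Free.chooseBasis ℤ B
  intro r
  obtain ⟨f, hf⟩ := MvPolynomial.map_surjective (Int.castRingHom (ZMod p)) ZMod.intCast_surjective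
    (SymmetricAlgebra.equivMvPolynomial (reduceBasis p b).dualBasis r)
  refine ⟨(SymmetricAlgebra.equivMvPolynomial b.dualBasis).symm f, ?_⟩
  apply (SymmetricAlgebra.equivMvPolynomial (reduceBasis p b).dualBasis).injective
  rw [equivMvPolynomial_reduceParameters, AlgEquiv.apply_symm_apply, hf]

/-- In coordinates this is the kernel of `ℤ[T] → 𝔽_p[T]`, generated by the kernel of `ℤ → 𝔽_p`. -/
theorem ker_reduceParameters :
    RingHom.ker (reduceParameters p : ParameterRing ℤ B →+* _) =
      Ideal.span {(p : ParameterRing ℤ B)} := by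
  classical
  let b := Module.Free.chooseBasis ℤ B
  let E := SymmetricAlgebra.equivMvPolynomial b.dualBasis
  ext s
  rw [RingHom.mem_ker, ← map_eq_zero_iff _
    (SymmetricAlgebra.equivMvPolynomial (reduceBasis p b).dualBasis).injective,
    equivMvPolynomial_reduceParameters, ← RingHom.mem_ker, MvPolynomial.ker_map,
    ZMod.ker_intCastRingHom, Ideal.map_span, Set.image_singleton, Ideal.mem_span_singleton,
    Ideal.mem_span_singleton, ← map_dvd_iff E]
  simp [E]

/-- The isomorphism `S / pS ≃ Sym((B / pB)^∨)`. -/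
def reduceParametersEquiv :
    (ParameterRing ℤ B ⧸ Ideal.span {(p : ParameterRing ℤ B)}) ≃+*
      ParameterRing (ZMod p) (B ⧸ Ideal.span {(p : B)}) :=
  (Ideal.quotEquivOfEq (ker_reduceParameters p).symm).trans
    (RingHom.quotientKerEquivOfSurjective (reduceParameters_surjective p))

theorem map_reduceParametersEquiv_polyModP (f : Polynomial (ParameterRing ℤ B)) :
    Polynomial.mapEquiv (reduceParametersEquiv p) (polyModP p f) = f.map (reduceParameters p) := by
  rw [Polynomial.mapEquiv_apply, polyModP, Polynomial.coe_mapRingHom, Polynomial.map_map]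
  rfl

variable [Fact p.Prime]

theorem residueCharpoly_monic (I : Ideal B) (h : Ideal.span {(p : B)} ≤ I) :
    (residueCharpoly p I h).Monic := by
  let : Algebra (ZMod p) (B ⧸ I) := zmodAlgebraQuotient p I h
  have : Module.Finite (ZMod p) (B ⧸ I) := finite_zmod_quotient p I
  rw [residueCharpoly_eq_pencilCharpoly p (Module.Free.chooseBasis ℤ B)]
  exact pencilCharpoly_monic _ _

/-- The reduction modulo `p` of the generic characteristic polynomial of `B`. -/
theorem genericCharpoly_map_reduceParameters :
    (genericCharpoly ℤ B).map (reduceParameters p) = residueCharpoly p _ le_rfl := by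
  classical
  let b := Module.Free.chooseBasis ℤ B
  have : Module.Finite (ZMod p) (B ⧸ Ideal.span {(p : B)}) := finite_zmod_quotient p _
  rw [residueCharpoly_eq_pencilCharpoly p b, genericCharpoly_eq_pencilCharpoly b,
    pencilCharpoly_eq_matrix b, pencilCharpoly_eq_matrix (reduceBasis p b), ← Matrix.charpoly_map]
  congr 1
  ext x y
  -- The structure constants of `B / pB` are the reductions of those of `B`.
  have h : ∀ j, (reduceBasis p b).repr (Ideal.Quotient.mk _ (b j * b y)) x =
      ((b.repr (b j * b y) x : ℤ) : ZMod p) := fun j =>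
    (congrArg (fun f => f (Ideal.Quotient.mk _ (b j * b y))) (reduceBasis_coord p b x)).trans
      (reduceDual_mk p _ _)
  simp only [Matrix.map_apply, Matrix.sum_apply, Matrix.smul_apply,
    map_sum, smul_eq_mul, map_mul, reduceParameters_ι, LinearMap.toMatrix_apply, mulLeft_apply,
    reduceBasis_apply]
  refine Finset.sum_congr rfl fun j _ => ?_
  rw [← map_mul (Ideal.Quotient.mk _), h]
  simp

theorem residueCharpoly_top (h : Ideal.span {(p : B)} ≤ ⊤) : residueCharpoly p ⊤ h = 1 := by
  let : Algebra (ZMod p) (B ⧸ (⊤ : Ideal B)) := zmodAlgebraQuotient p ⊤ h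
  have : Module.Finite (ZMod p) (B ⧸ (⊤ : Ideal B)) := finite_zmod_quotient p ⊤
  rw [residueCharpoly_eq_pencilCharpoly p (Module.Free.chooseBasis ℤ B),
    pencilCharpoly_eq_matrix (Module.Basis.empty (ι := Empty) (B ⧸ (⊤ : Ideal B)))]
  exact Matrix.charpoly_isEmpty

/-- Multiplicativity along `0 → B / P → B / JP → B / J → 0`. -/
theorem residueCharpoly_mul [IsDedekindDomain B] (J P : Ideal B) (hJ : J ≠ 0) (hP : P.IsMaximal)
    (h : Ideal.span {(p : B)} ≤ J * P) :
    residueCharpoly p (J * P) h =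
      residueCharpoly p J (h.trans Ideal.mul_le_left) *
        residueCharpoly p P (h.trans Ideal.mul_le_right) := by
  -- `J ≠ JP` by cancelling `J`. Any such `a` generates `J / JP`, and multiplication by `a` will
  -- induce `B / P ≃ J / JP`.
  obtain ⟨a, haJ, haP⟩ : ∃ a ∈ J, a ∉ J * P := by
    by_contra! H
    have : J * ⊤ ≤ J * P := by rw [Ideal.mul_top]; exact H
    exact hP.ne_top (top_le_iff.mp (Ideal.dvd_iff_le.mp ((mul_dvd_mul_iff_left hJ).mp
      (Ideal.dvd_iff_le.mpr this))))
  -- Write the left side as `JQ` with `Q ⊇ P`; maximality leaves `Q = ⊤` or `Q = P`, and the latter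
  -- would put `a` in `JP`.
  have hspan : Ideal.span {a} ⊔ J * P = J := by
    have hle : Ideal.span {a} ⊔ J * P ≤ J :=
      sup_le ((Ideal.span_singleton_le_iff_mem _).mpr haJ) Ideal.mul_le_left
    obtain ⟨Q, hQ⟩ := Ideal.dvd_iff_le.mpr hle
    have hPQ : P ≤ Q := Ideal.dvd_iff_le.mp ((mul_dvd_mul_iff_left hJ).mp
      (Ideal.dvd_iff_le.mpr (hQ ▸ le_sup_right)))
    by_cases hQt : Q = ⊤
    · rw [hQ, hQt, Ideal.mul_top]
    · have haQ : a ∈ J * Q := hQ ▸ Ideal.mem_sup_left (Ideal.mem_span_singleton_self a)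
      rw [← hP.eq_of_le hQt hPQ] at haQ
      exact (haP haQ).elim
  -- An `x ∉ P` is invertible modulo `P`, so `a * x ∈ JP` would force `a ∈ JP`.
  have hmem : ∀ x, a * x ∈ J * P ↔ x ∈ P := by
    refine fun x => ⟨fun hx => ?_, fun hx => Ideal.mul_mem_mul haJ hx⟩
    by_contra hxP
    obtain ⟨y, z, hz, hyz⟩ := hP.exists_inv hxP
    apply haP
    have : a = y * (a * x) + a * z := by linear_combination (-a) * hyz
    rw [this]
    exact add_mem (Ideal.mul_mem_left _ _ hx) (Ideal.mul_mem_mul haJ hz)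
  let : Algebra (ZMod p) (B ⧸ J * P) := zmodAlgebraQuotient p _ h
  have : Module.Finite (ZMod p) (B ⧸ J * P) := finite_zmod_quotient p _
  let : Algebra (ZMod p) (B ⧸ J) := zmodAlgebraQuotient p _ (h.trans Ideal.mul_le_left)
  have : Module.Finite (ZMod p) (B ⧸ J) := finite_zmod_quotient p _
  let : Algebra (ZMod p) (B ⧸ P) := zmodAlgebraQuotient p _ (h.trans Ideal.mul_le_right)
  have : Module.Finite (ZMod p) (B ⧸ P) := finite_zmod_quotient p _
  let b := Module.Free.chooseBasis ℤ B
  rw [mul_comm (residueCharpoly p J _), residueCharpoly_eq_pencilCharpoly p b,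
    residueCharpoly_eq_pencilCharpoly p b, residueCharpoly_eq_pencilCharpoly p b]
  let g : (B ⧸ P) →ₗ[ZMod p] B ⧸ J * P := AddMonoidHom.toZModLinearMap p
    (Submodule.mapQ P (J * P) (LinearMap.mulLeft B a) fun x hx => (hmem x).mpr hx).toAddMonoidHom
  let f : (B ⧸ J * P) →ₗ[ZMod p] B ⧸ J := AddMonoidHom.toZModLinearMap p
    (Ideal.Quotient.factor (Ideal.mul_le_left : J * P ≤ J)).toAddMonoidHom
  have hg : ∀ x, g (Ideal.Quotient.mk P x) = Ideal.Quotient.mk (J * P) (a * x) := fun x => rfl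
  have hf : ∀ x, f (Ideal.Quotient.mk (J * P) x) = Ideal.Quotient.mk J x := fun x => rfl
  refine pencilCharpoly_of_exact (g := g) (h := f) ?_ ?_ ?_ _ ?_ ?_
  · rw [injective_iff_map_eq_zero]
    intro x hx
    obtain ⟨x, rfl⟩ := Ideal.Quotient.mk_surjective x
    rw [hg, Ideal.Quotient.eq_zero_iff_mem] at hx
    exact Ideal.Quotient.eq_zero_iff_mem.mpr ((hmem x).mp hx)
  · intro x
    obtain ⟨x, rfl⟩ := Ideal.Quotient.mk_surjective x
    exact ⟨_, hf x⟩
  · intro x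
    obtain ⟨x, rfl⟩ := Ideal.Quotient.mk_surjective x
    rw [hf, Ideal.Quotient.eq_zero_iff_mem]
    constructor
    · intro hx
      rw [← hspan, Submodule.mem_sup] at hx
      obtain ⟨y, hy, z, hz, rfl⟩ := hx
      obtain ⟨c, rfl⟩ := Ideal.mem_span_singleton'.mp hy
      refine ⟨Ideal.Quotient.mk P c, ?_⟩
      rw [hg, map_add, Ideal.Quotient.eq_zero_iff_mem.mpr hz, add_zero, mul_comm c]
    · rintro ⟨y, hy⟩
      obtain ⟨y, rfl⟩ := Ideal.Quotient.mk_surjective y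
      rw [hg, Ideal.Quotient.eq] at hy
      have := J.sub_mem (J.mul_mem_right y haJ) (Ideal.mul_le_left hy)
      rwa [sub_sub_cancel] at this
  · intro j x
    obtain ⟨x, rfl⟩ := Ideal.Quotient.mk_surjective x
    rw [mulLeft_apply, mulLeft_apply, hg, ← map_mul, ← map_mul, hg, mul_left_comm]
  · intro j x
    obtain ⟨x, rfl⟩ := Ideal.Quotient.mk_surjective x
    rw [mulLeft_apply, mulLeft_apply, hf, ← map_mul, ← map_mul, hf]

/-- The ideal `I` is a variable tied to the product by an equation, so that the induction can change
the quotient `B / I` and its algebra structure. -/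
theorem residueCharpoly_prod [IsDedekindDomain B] {ι : Type*} (P : ι → Ideal B)
    (hP : ∀ i, (P i).IsMaximal) (hP₀ : ∀ i, P i ≠ 0) (h : ∀ i, Ideal.span {(p : B)} ≤ P i)
    (s : Multiset ι) (I : Ideal B) (hI : Ideal.span {(p : B)} ≤ I) (hIs : I = (s.map P).prod) :
    residueCharpoly p I hI = (s.map fun i => residueCharpoly p (P i) (h i)).prod := by
  induction s using Multiset.induction_on generalizing I with
  | empty =>
    rw [Multiset.map_zero, Multiset.prod_zero, Ideal.one_eq_top] at hIs
    subst hIs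
    rw [residueCharpoly_top, Multiset.map_zero, Multiset.prod_zero]
  | cons i s ih =>
    rw [Multiset.map_cons, Multiset.prod_cons, mul_comm] at hIs
    subst hIs
    have h₀ : (s.map P).prod ≠ 0 := Multiset.prod_ne_zero fun h0 => by
      obtain ⟨j, -, hj⟩ := Multiset.mem_map.mp h0
      exact hP₀ j hj
    rw [residueCharpoly_mul p _ _ h₀ (hP i) hI, ih _ _ rfl, Multiset.map_cons, Multiset.prod_cons,
      mul_comm]

instance isDomain_parameterRing {k A : Type*} [Field k] [CommRing A] [Algebra k A] :
    IsDomain (ParameterRing k A) :=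
  (SymmetricAlgebra.equivMvPolynomial (Module.Basis.ofVectorSpace k _)).toMulEquiv.isDomain _

/-- A factorization of a monic polynomial over a domain survives specialization. At a primitive
element of the finite field `B / P` the characteristic and minimal polynomials have the same degree,
hence coincide. -/
theorem residueCharpoly_irreducible (P : Ideal B) (hP : P.IsMaximal)
    (h : Ideal.span {(p : B)} ≤ P) : Irreducible (residueCharpoly p P h) := by
  let : Algebra (ZMod p) (B ⧸ P) := zmodAlgebraQuotient p P h
  have : Module.Finite (ZMod p) (B ⧸ P) := finite_zmod_quotient p P
  let : Field (B ⧸ P) := Ideal.Quotient.field P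
  obtain ⟨θ, hθ⟩ := Field.exists_primitive_element_of_finite_bot (ZMod p) (B ⧸ P)
  obtain ⟨x, rfl⟩ := Ideal.Quotient.mk_surjective θ
  have hint : IsIntegral (ZMod p) (Ideal.Quotient.mk P x) := Algebra.IsIntegral.isIntegral _
  refine (residueCharpoly_monic p P h).irreducible_of_irreducible_map
    (evalParameters (k := ZMod p) (Ideal.Quotient.mk (Ideal.span {(p : B)}) x)).toRingHom _ ?_
  rw [residueCharpoly_map_eval]
  have hle : (mulLeft (ZMod p) (Ideal.Quotient.mk P x)).charpoly =
      minpoly (ZMod p) (Ideal.Quotient.mk P x) := by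
    refine Polynomial.eq_of_monic_of_dvd_of_natDegree_le (minpoly.monic hint)
      (LinearMap.charpoly_monic (mulLeft (ZMod p) (Ideal.Quotient.mk P x)))
      (minpoly.dvd _ _ ?_) ?_
    · exact Algebra.aeval_self_charpoly_lmul _
    · rw [(Field.primitive_element_iff_minpoly_natDegree_eq (ZMod p)
        (Ideal.Quotient.mk P x)).mp hθ]
      exact (LinearMap.charpoly_natDegree (R := ZMod p) (M := B ⧸ P) _).le
  rw [hle]
  exact minpoly.irreducible hint

end Reduction

end GenericElement

end
theorem mainTheorem10 (K : Type*) [Field K] [NumberField K] (p : ℕ) [Fact p.Prime]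
    {ι : Type*} [Fintype ι] (P : ι → Ideal (NumberField.RingOfIntegers K)) (e : ι → ℕ)
    (hprime : ∀ i, (P i).IsPrime) (hinj : Function.Injective P) (he : ∀ i, e i ≠ 0)
    (hfac : Ideal.span {(p : NumberField.RingOfIntegers K)} = ∏ i, P i ^ e i) :
    ∃ Pi : ι → Polynomial (ParameterRing ℤ (NumberField.RingOfIntegers K)),
      -- `Π_i` reduces to the image of the generic characteristic polynomial of `B / P_i`
      (∀ i, ∃ h : Ideal.span {(p : NumberField.RingOfIntegers K)} ≤ P i,
        (Pi i).map (reduceParameters p) = residueCharpoly p (P i) h) ∧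
      -- `F ≡ ∏ Π_i ^ e_i mod p`
      polyModP p (genericCharpoly ℤ (NumberField.RingOfIntegers K)) =
        polyModP p (∏ i, Pi i ^ e i) ∧
      -- the `Π_i` are irreducible modulo `p` and pairwise distinct modulo `p`
      (∀ i, Irreducible (polyModP p (Pi i))) ∧
      Function.Injective (fun i => polyModP p (Pi i)) := by
  have hle : ∀ i, Ideal.span {(p : NumberField.RingOfIntegers K)} ≤ P i := fun i =>
    Ideal.dvd_iff_le.mp (hfac ▸ (dvd_pow_self (P i) (he i)).trans
      (Finset.dvd_prod_of_mem (fun i => P i ^ e i) (Finset.mem_univ i)))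
  have hp₀ : (p : NumberField.RingOfIntegers K) ≠ 0 :=
    Nat.cast_ne_zero.mpr (Fact.out : p.Prime).ne_zero
  have hP₀ : ∀ i, P i ≠ 0 := fun i h0 => hp₀ <| by
    have := hle i
    rwa [h0, Ideal.zero_eq_bot, le_bot_iff, Ideal.span_singleton_eq_bot] at this
  have hmax : ∀ i, (P i).IsMaximal := fun i => (hprime i).isMaximal (hP₀ i)
  -- Any coefficientwise lifts will do: all the claims depend only on the reductions.
  choose Pi hPi using fun i => Polynomial.map_surjective _ (reduceParameters_surjective p)
    (residueCharpoly p (P i) (hle i))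
  refine ⟨Pi, fun i => ⟨hle i, hPi i⟩, ?_, fun i => ?_, fun i j hij => ?_⟩
  · apply (Polynomial.mapEquiv (reduceParametersEquiv p)).injective
    rw [map_reduceParametersEquiv_polyModP, map_reduceParametersEquiv_polyModP,
      genericCharpoly_map_reduceParameters, Polynomial.map_prod,
      residueCharpoly_prod p P hmax hP₀ hle (∑ i, e i • {i}) _ le_rfl
        (hfac.trans (prod_map_sum_nsmul_singleton e P).symm), prod_map_sum_nsmul_singleton]
    simp_rw [Polynomial.map_pow, hPi]
  · rw [← MulEquiv.irreducible_iff (Polynomial.mapEquiv (reduceParametersEquiv p)),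
      map_reduceParametersEquiv_polyModP, hPi]
    exact residueCharpoly_irreducible p (P i) (hmax i) (hle i)
  · have h := congrArg (Polynomial.mapEquiv (reduceParametersEquiv p)) hij
    simp only [map_reduceParametersEquiv_polyModP, hPi] at h
    exact hinj (residueCharpoly_injective p (hmax i) (hmax j) h)
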